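/- Let $X\neq\{0\}$ be a real Banach space with closed unit ball $B_X$, unit sphere $S_X$ and dual $X^*$. For $x^*\in S_{X^*}$ and $\varepsilon>0$ put $S(x^*,\varepsilon)=\{x\in B_X : x^*(x)>1-\varepsilon\}$, and for $x\in S_X$ and $\varepsilon>0$ put $S(x,\varepsilon)=\{x^*\in B_{X^*} : x^*(x)>1-\varepsilon\}$. The space $X$ has the local diameter 2 property+ (LD2P+) if for every $x^*\in S_{X^*}$, every $\varepsilon>0$, every $\delta>0$ and every $x\in S(x^*,\varepsilon)\cap S_X$ there exists $y\in S(x^*,\varepsilon)$ with $\|x-y\|>2-\delta$. A point $x^*\in B_{X^*}$ is a weak$^*$-denting point of $B_{X^*}$ if for every $\eta>0$ there are $x\in S_X$ and $\delta>0$ such that $x^*\in S(x,\delta)$ and $S(x,\delta)$ has norm diameter less than $\eta$. A Banach space $E$ has the Radon–Nikodým property if for every finite measure space $(\Omega,\Sigma,\mu)$ and every countably additive $G:\Sigma\to E$ of bounded variation that vanishes on all $\mu$-null sets there is a Bochner integrable $g:\Omega\to E$ with $G(A)=\int_A g\,d\mu$ for all $A\in\Sigma$. If $B_{X^*}$ contains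 a weak$^*$-denting point, then $X$ does not have the LD2P+. In particular, if $X^*$ has the Radon–Nikodým property, then $X$ does not have the LD2P+. -/

import Mathlib

open MeasureTheory

namespace LocalDiameterTwo

/-- The slice `S(f, ε) = {x ∈ B_X : f x > 1 - ε}` of the closed unit ball of `X`
(used with `‖f‖ = 1` and `ε > 0`). -/
def slice {X : Type*} [NormedAddCommGroup X] [NormedSpace ℝ X]
    (f : StrongDual ℝ X) (ε : ℝ) : Set X :=
  {x | ‖x‖ ≤ 1 ∧ 1 - ε < f x}

/-- The weak* slice `S(x, ε) = {f ∈ B_{X*} : f x > 1 - ε}` of the closed dual unit ball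
(used with `‖x‖ = 1` and `ε > 0`). -/
def weakStarSlice {X : Type*} [NormedAddCommGroup X] [NormedSpace ℝ X]
    (x : X) (ε : ℝ) : Set (StrongDual ℝ X) :=
  {f | ‖f‖ ≤ 1 ∧ 1 - ε < f x}

/-- The local diameter 2 property+ (LD2P+): in every slice `S` of the unit ball, every norm-one
point of `S` is at distance as close to `2` as we want from some other point of `S`. -/
def LD2PPlus (X : Type*) [NormedAddCommGroup X] [NormedSpace ℝ X] : Prop :=
  ∀ f : StrongDual ℝ X, ‖f‖ = 1 → ∀ ε : ℝ, 0 < ε → ∀ δ : ℝ, 0 < δ →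
    ∀ x ∈ slice f ε, ‖x‖ = 1 → ∃ y ∈ slice f ε, 2 - δ < ‖x - y‖

/-- `f` is a weak*-denting point of the dual unit ball: it belongs to weak* slices of the ball of
arbitrarily small norm diameter. (Slices are bounded, so `Metric.diam` is their true diameter.) -/
def IsWeakStarDentingPoint {X : Type*} [NormedAddCommGroup X] [NormedSpace ℝ X]
    (f : StrongDual ℝ X) : Prop :=
  ‖f‖ ≤ 1 ∧ ∀ η : ℝ, 0 < η → ∃ x : X, ‖x‖ = 1 ∧ ∃ δ : ℝ, 0 < δ ∧
    f ∈ weakStarSlice x δ ∧ Metric.diam (weakStarSlice x δ) < η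

/-- The Radon–Nikodým property: for every finite measure space `(Ω, μ)`, every countably additive
`E`-valued measure on `Ω` that is of bounded variation and vanishes on the `μ`-null sets has a
Bochner integrable density with respect to `μ`.

Only the base universe is used for `Ω`; this loses nothing, since the property is already
decided by Lebesgue measure on `[0, 1]`. -/
def RadonNikodymProperty (E : Type*) [NormedAddCommGroup E] [NormedSpace ℝ E] : Prop :=
  ∀ (Ω : Type) [MeasurableSpace Ω] (μ : Measure Ω) [IsFiniteMeasure μ] (G : VectorMeasure Ω E),
    G.variation Set.univ < ⊤ →
    (∀ s : Set Ω, MeasurableSet s → μ s = 0 → G s = 0) →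
    ∃ g : Ω → E, Integrable g μ ∧ ∀ s : Set Ω, MeasurableSet s → G s = ∫ ω in s, g ω ∂μ

end LocalDiameterTwo

/-!
By the Hahn–Banach theorem, the LD2P+ forces every weak* slice of the dual ball to have diameter
`2`, so it contradicts the existence of a single small one.

The Radon–Nikodým property provides such a slice. Suppose that all weak* slices are large. Then, by
the Krein–Milman theorem and the Bourgain–Namioka superlemma, outside every weak* compact convex
proper subset of the ball there are two extreme points at a large distance, and a vector `x`
separating them. Enlarging the subset in two ways, once by the part of the ball where `x` is small
and once by the part where it is large, and iterating, one grows a dyadic tree in the ball in which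
all descendants of one child of a node lie far from all descendants of its other child. Averaging
the `n`-th level of the tree over coin tosses and letting `n` tend to infinity gives a vector
measure, dominated by the coin-tossing measure, whose values on the two halves of any cylinder
differ by a fixed proportion of the measure of the cylinder. It has no Bochner density, because an
integrable function is nearly constant in mean on some cylinder.
-/

namespace LocalDiameterTwo

open Filter Topology
open scoped Pointwise

section ExtremePoints

variable {E : Type*} [AddCommGroup E] [Module ℝ E] {K L M D : Set E} {e : E}

lemma mem_or_mem_of_mem_extremePoints_of_mem_convexJoin (he : e ∈ K.extremePoints ℝ)
    (hL : L ⊆ K) (hM : M ⊆ K) (h : e ∈ convexJoin ℝ L M) : e ∈ L ∨ e ∈ M := by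
  obtain ⟨l, hl, m, hm, hlm⟩ := mem_convexJoin.mp h
  rcases (mem_extremePoints_iff_forall_segment.mp he).2 l (hL hl) m (hM hm) hlm with rfl | rfl
  exacts [.inl hl, .inr hm]

variable [TopologicalSpace E]

/-- `L` is a nonempty compact convex proper subset of `K`. When `K` is compact and convex, `K \ L`
still contains an extreme point of `K`, and the branching constructions shrink such remainders. -/
structure IsProperCompactConvex (L K : Set E) : Prop where
  nonempty : L.Nonempty
  isCompact : IsCompact L
  convex : Convex ℝ L
  ssubset : L ⊂ K

variable [IsTopologicalAddGroup E] [ContinuousSMul ℝ E]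

lemma isCompact_convexJoin (hL : IsCompact L) (hM : IsCompact M) :
    IsCompact (convexJoin ℝ L M) := by
  convert! (hL.prod (hM.prod (isCompact_Icc (a := (0 : ℝ)) (b := 1)))).image
    (f := fun p : E × E × ℝ => AffineMap.lineMap p.1 p.2.1 p.2.2)
    (by simp only [AffineMap.lineMap_apply_module]; fun_prop) using 1
  ext z
  simp only [mem_convexJoin, segment_eq_image_lineMap, Set.mem_image, Set.mem_prod, Prod.exists]
  exact ⟨fun ⟨l, hl, m, hm, t, ht, h⟩ => ⟨l, m, t, ⟨hl, hm, ht⟩, h⟩,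
    fun ⟨l, m, t, ⟨hl, hm, ht⟩, h⟩ => ⟨l, hl, m, hm, t, ht, h⟩⟩

lemma IsProperCompactConvex.join (hL : IsProperCompactConvex L K) (hK : Convex ℝ K)
    (hM : IsCompact M) (hMc : Convex ℝ M) (hMne : M.Nonempty) (hMK : M ⊆ K)
    (he : e ∈ K.extremePoints ℝ) (heL : e ∉ L) (heM : e ∉ M) :
    IsProperCompactConvex (convexJoin ℝ L M) K where
  nonempty := hL.nonempty.mono (subset_convexJoin_left hMne)
  isCompact := isCompact_convexJoin hL.isCompact hM
  convex := hL.convex.convexJoin hMc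
  ssubset := (Set.ssubset_iff_of_subset (convexJoin_subset hL.ssubset.1 hMK hK)).mpr
    ⟨e, he.1, fun h =>
      (mem_or_mem_of_mem_extremePoints_of_mem_convexJoin he hL.ssubset.1 hMK h).elim heL heM⟩

lemma IsProperCompactConvex.exists_superset_forall_lt [T2Space E]
    (hL : IsProperCompactConvex L K) (hK : IsCompact K) (hKc : Convex ℝ K)
    (he : e ∈ K.extremePoints ℝ \ L) (φ : StrongDual ℝ E) {c : ℝ} (hc : c < φ e)
    (hne : ∃ f ∈ K, φ f ≤ c) :
    ∃ L', IsProperCompactConvex L' K ∧ L ⊆ L' ∧ ∀ f ∈ K \ L', c < φ f := by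
  let M : Set E := K ∩ {f | φ f ≤ c}
  have hM : IsCompact M := hK.inter_right (isClosed_le φ.continuous continuous_const)
  have hMc : Convex ℝ M := hKc.inter (convex_halfSpace_le φ.isLinear c)
  refine ⟨_, hL.join hKc hM hMc hne Set.inter_subset_left he.1 he.2 fun h => hc.not_ge h.2,
    subset_convexJoin_left hne, fun f hf => ?_⟩
  by_contra! hfc
  exact hf.2 (subset_convexJoin_right hL.nonempty ⟨hf.1, hfc⟩)

variable [T2Space E] [LocallyConvexSpace ℝ E]

lemma subset_of_extremePoints_subset (hK : IsCompact K) (hKc : Convex ℝ K) (hL : IsClosed L)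
    (hLc : Convex ℝ L) (h : K.extremePoints ℝ ⊆ L) : K ⊆ L :=
  closure_convexHull_extremePoints hK hKc ▸ closure_minimal (convexHull_min h hLc) hL

lemma IsProperCompactConvex.nonempty_extremePoints_sdiff (hL : IsProperCompactConvex L K)
    (hK : IsCompact K) (hKc : Convex ℝ K) : (K.extremePoints ℝ \ L).Nonempty := by
  rw [Set.sdiff_nonempty]
  exact fun h =>
    hL.ssubset.2 (subset_of_extremePoints_subset hK hKc hL.isCompact.isClosed hL.convex h)

-- The convex step of the Bourgain–Namioka superlemma: an extreme point outside `L` is not of the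
-- form `lineMap d l t` with `t ≥ r > 0`, so `L'` can absorb all such points.
lemma IsProperCompactConvex.exists_forall_eq_lineMap (hL : IsProperCompactConvex L K)
    (hK : IsCompact K) (hKc : Convex ℝ K) (hD : IsCompact D) (hDc : Convex ℝ D) (hDK : D ⊆ K)
    (hext : K.extremePoints ℝ \ L ⊆ D) {r : ℝ} (hr : r ∈ Set.Ioo (0 : ℝ) 1) :
    ∃ L', IsProperCompactConvex L' K ∧
      ∀ f ∈ K \ L', ∃ d ∈ D, ∃ l ∈ L, ∃ t ∈ Set.Ico 0 r, f = AffineMap.lineMap d l t := by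
  obtain ⟨e, he, heL⟩ := hL.nonempty_extremePoints_sdiff hK hKc
  have hDne : D.Nonempty := ⟨e, hext ⟨he, heL⟩⟩
  have hKLD : K ⊆ convexJoin ℝ L D := by
    refine subset_of_extremePoints_subset hK hKc (isCompact_convexJoin hL.isCompact hD).isClosed
      (hL.convex.convexJoin hDc) fun f hf => ?_
    by_cases hfL : f ∈ L
    · exact subset_convexJoin_left hDne hfL
    · exact subset_convexJoin_right hL.nonempty (hext ⟨hf, hfL⟩)
  let M : Set E := Set.image2 (fun d l => AffineMap.lineMap d l r) D L
  have hMsum : M = (1 - r) • D + r • L := by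
    simp only [M, AffineMap.lineMap_apply_module, ← Set.image2_add, ← Set.image_smul,
      Set.image2_image_left, Set.image2_image_right]
  have hM : IsCompact M := hMsum ▸ (hD.smul _).add (hL.isCompact.smul _)
  have hMc : Convex ℝ M := hMsum ▸ (hDc.smul _).add (hL.convex.smul _)
  have hMK : M ⊆ K := Set.image2_subset_iff.mpr fun d hd l hl =>
    hKc.lineMap_mem (hDK hd) (hL.ssubset.1 hl) ⟨hr.1.le, hr.2.le⟩
  have heM : e ∉ M := by
    rintro ⟨d, hd, l, hl, rfl⟩
    have := (mem_extremePoints.mp he).2 d (hDK hd) l (hL.ssubset.1 hl)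
      (lineMap_mem_openSegment ℝ d l hr)
    exact heL (this.2 ▸ hl)
  refine ⟨_, hL.join hKc hM hMc (hDne.image2 hL.nonempty) hMK he heL heM,
    fun f ⟨hfK, hf⟩ => ?_⟩
  obtain ⟨l, hl, d, hd, hfld⟩ := mem_convexJoin.mp (hKLD hfK)
  rw [segment_symm, segment_eq_image_lineMap] at hfld
  obtain ⟨t, ht, rfl⟩ := hfld
  refine ⟨d, hd, l, hl, t, ⟨ht.1, ?_⟩, rfl⟩
  by_contra! hrt
  refine hf (mem_convexJoin.mpr ⟨l, hl, _, Set.mem_image2_of_mem hd hl, ?_⟩)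
  have ht' : t ∈ segment ℝ 1 r := by
    rw [segment_symm, segment_eq_Icc hr.2.le]
    exact ⟨hrt, ht.2⟩
  have := image_segment ℝ (AffineMap.lineMap (k := ℝ) d l) 1 r ▸ Set.mem_image_of_mem _ ht'
  rwa [AffineMap.lineMap_apply_one] at this

lemma IsProperCompactConvex.exists_extremePoints_far {q : Seminorm ℝ E}
    (hq : LowerSemicontinuous q) (hK : IsCompact K) (hKc : Convex ℝ K) {R ε δ : ℝ}
    (hR : ∀ f ∈ K, ∀ g ∈ K, q (f - g) ≤ R)
    (hfar : ∀ L, IsProperCompactConvex L K → ∃ f ∈ K \ L, ∃ g ∈ K \ L, ε < q (f - g))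
    (hδ : 2 * δ < ε) (hL : IsProperCompactConvex L K) :
    ∃ f ∈ K.extremePoints ℝ \ L, ∃ g ∈ K.extremePoints ℝ \ L, δ < q (f - g) := by
  obtain ⟨e, he⟩ := hL.nonempty_extremePoints_sdiff hK hKc
  by_contra! hnear
  obtain ⟨c, hc, hcR⟩ := exists_pos_mul_lt (sub_pos.mpr hδ) (2 * R)
  have hball : IsClosed (q.closedBall e δ) := by
    have hcont : Continuous fun f : E => f - e := by fun_prop
    exact (lowerSemicontinuous_iff_isClosed_preimage.mp hq δ).preimage hcont
  have hr : min c (1 / 2) ∈ Set.Ioo (0 : ℝ) 1 :=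
    ⟨lt_min hc one_half_pos, (min_le_right _ _).trans_lt one_half_lt_one⟩
  obtain ⟨L', hL', hLD⟩ := hL.exists_forall_eq_lineMap hK hKc (hK.inter_right hball)
    (hKc.inter (q.convex_closedBall e δ)) Set.inter_subset_left
    (fun f hf => ⟨hf.1.1, hnear f hf e he⟩) hr
  have hdist : ∀ f ∈ K \ L', q (f - e) ≤ c * R + δ := by
    intro f hf
    obtain ⟨d, ⟨hdK, hd⟩, l, hl, t, ht, rfl⟩ := hLD f hf
    calc q (AffineMap.lineMap d l t - e) = q (t • (l - d) + (d - e)) := by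
          rw [AffineMap.lineMap_apply]; simp [add_sub_assoc]
      _ ≤ q (t • (l - d)) + q (d - e) := map_add_le_add q _ _
      _ ≤ c * R + δ := by
        rw [map_smul_eq_mul, Real.norm_of_nonneg ht.1]
        gcongr
        · exact ht.2.le.trans (min_le_left _ _)
        · exact hR l (hL.ssubset.1 hl) d hdK
        · exact hd
  obtain ⟨f, hf, g, hg, hfg⟩ := hfar L' hL'
  have := map_sub_le_add q (f - e) (g - e)
  rw [sub_sub_sub_cancel_right] at this
  linarith [hdist f hf, hdist g hg]

end ExtremePoints

section DualBall

variable {X : Type*} [NormedAddCommGroup X] [NormedSpace ℝ X]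

variable (X) in
/-- The dual norm as a seminorm on the dual with its weak* topology, for which it is only lower
semicontinuous. -/
noncomputable def dualSeminorm : Seminorm ℝ (WeakDual ℝ X) :=
  (normSeminorm ℝ (StrongDual ℝ X)).comp WeakDual.toStrongDual.toLinearMap

variable (X) in
/-- The closed dual unit ball, as a subset of the dual with its weak* topology. -/
def dualUnitBall : Set (WeakDual ℝ X) :=
  WeakDual.toStrongDual ⁻¹' Metric.closedBall 0 1

lemma dualSeminorm_apply (f : WeakDual ℝ X) :
    dualSeminorm X f = ‖WeakDual.toStrongDual f‖ := rfl

lemma mem_dualUnitBall {f : WeakDual ℝ X} :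
    f ∈ dualUnitBall X ↔ ‖WeakDual.toStrongDual f‖ ≤ 1 := mem_closedBall_zero_iff

lemma lowerSemicontinuous_dualSeminorm : LowerSemicontinuous (dualSeminorm X) := by
  rw [lowerSemicontinuous_iff_isClosed_preimage]
  intro r
  convert! WeakDual.isClosed_closedBall (𝕜 := ℝ) (0 : StrongDual ℝ X) r using 1
  ext f
  simp [dualSeminorm_apply]

lemma isCompact_dualUnitBall : IsCompact (dualUnitBall X) :=
  WeakDual.isCompact_closedBall 0 1

lemma convex_dualUnitBall : Convex ℝ (dualUnitBall X) :=
  (convex_closedBall (0 : StrongDual ℝ X) 1).linear_preimage WeakDual.toStrongDual.toLinearMap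

instance locallyConvexSpace_weakDual : LocallyConvexSpace ℝ (WeakDual ℝ X) :=
  (WeakDual.withSeminorms (𝕜 := ℝ) (E := X)).toLocallyConvexSpace

lemma exists_weakStarSlice_disjoint {L : Set (WeakDual ℝ X)}
    (hL : IsProperCompactConvex L (dualUnitBall X)) :
    ∃ x : X, ‖x‖ = 1 ∧ ∃ δ > 0, ∀ f ∈ weakStarSlice x δ, StrongDual.toWeakDual f ∉ L := by
  obtain ⟨f₀, hf₀, hf₀L⟩ := Set.exists_of_ssubset hL.ssubset
  obtain ⟨φ, u, hφL, hφf₀⟩ :=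
    geometric_hahn_banach_closed_point hL.convex hL.isCompact.isClosed hf₀L
  obtain ⟨y, rfl⟩ := LinearMap.dualEmbedding_surjective (topDualPairing ℝ X) φ
  replace hφL : ∀ l ∈ L, l y < u := hφL
  replace hφf₀ : u < f₀ y := hφf₀
  have hy : y ≠ 0 := by
    rintro rfl
    obtain ⟨l, hl⟩ := hL.nonempty
    exact (map_zero f₀ ▸ hφf₀).not_gt (map_zero l ▸ hφL l hl)
  have hypos : 0 < ‖y‖ := norm_pos_iff.mpr hy
  have huy : u < ‖y‖ := hφf₀.trans_le <| (le_abs_self _).trans <|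
    ((WeakDual.toStrongDual f₀).le_of_opNorm_le (mem_dualUnitBall.mp hf₀) y).trans_eq (one_mul _)
  refine ⟨‖y‖⁻¹ • y, norm_smul_inv_norm (𝕜 := ℝ) hy, 1 - u / ‖y‖,
    sub_pos.mpr ((div_lt_one hypos).mpr huy), fun f hf hfL => (hφL _ hfL).not_gt ?_⟩
  have := hf.2
  rwa [map_smul, smul_eq_mul, sub_sub_cancel, inv_mul_eq_div,
    div_lt_div_iff_of_pos_right hypos] at this

lemma exists_lt_dualSeminorm_sub {L : Set (WeakDual ℝ X)} {ε r : ℝ}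
    (hdiam : ∀ x : X, ‖x‖ = 1 → ∀ δ > 0, ε ≤ Metric.diam (weakStarSlice x δ))
    (hr : 0 ≤ r) (hrε : r < ε) (hL : IsProperCompactConvex L (dualUnitBall X)) :
    ∃ f ∈ dualUnitBall X \ L, ∃ g ∈ dualUnitBall X \ L, r < dualSeminorm X (f - g) := by
  obtain ⟨x, hx, δ, hδ, hdisj⟩ := exists_weakStarSlice_disjoint hL
  have hmem : ∀ f ∈ weakStarSlice x δ, StrongDual.toWeakDual f ∈ dualUnitBall X \ L :=
    fun f hf => ⟨mem_dualUnitBall.mpr hf.1, hdisj f hf⟩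
  by_contra! hnear
  refine (hrε.trans_le (hdiam x hx δ hδ)).not_ge ?_
  refine Metric.diam_le_of_forall_dist_le hr fun f hf g hg => ?_
  simpa [dualSeminorm_apply, dist_eq_norm] using hnear _ (hmem f hf) _ (hmem g hg)

lemma exists_lt_apply_of_lt_norm {f : StrongDual ℝ X} {r : ℝ} (h : r < ‖f‖) :
    ∃ x, ‖x‖ ≤ 1 ∧ r < f x := by
  obtain ⟨x, hx, hfx⟩ := f.exists_lt_apply_of_lt_opNorm h
  rcases lt_abs.mp hfx with hpos | hneg
  · exact ⟨x, hx.le, hpos⟩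
  · exact ⟨-x, (norm_neg x).trans_le hx.le, by rwa [map_neg]⟩

lemma exists_separating_extensions {L : Set (WeakDual ℝ X)} {ε δ : ℝ}
    (hdiam : ∀ x : X, ‖x‖ = 1 → ∀ δ > 0, ε ≤ Metric.diam (weakStarSlice x δ))
    (hδ : 0 < δ) (hδε : 2 * δ < ε) (hL : IsProperCompactConvex L (dualUnitBall X)) :
    ∃ x : X, ‖x‖ ≤ 1 ∧ ∃ a, ∃ C : Bool → Set (WeakDual ℝ X),
      (∀ b, IsProperCompactConvex (C b) (dualUnitBall X) ∧ L ⊆ C b) ∧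
      (∀ f ∈ dualUnitBall X \ C false, a + δ ≤ f x) ∧
      (∀ f ∈ dualUnitBall X \ C true, f x ≤ a) := by
  obtain ⟨r, hδr, hrε⟩ := exists_between hδε
  obtain ⟨f, hf, g, hg, hfg⟩ := hL.exists_extremePoints_far (R := 2)
    lowerSemicontinuous_dualSeminorm isCompact_dualUnitBall convex_dualUnitBall
    (fun f hf g hg => (map_sub_le_add _ f g).trans
      (one_add_one_eq_two (R := ℝ) ▸
        add_le_add (mem_dualUnitBall.mp hf) (mem_dualUnitBall.mp hg)))
    (fun L => exists_lt_dualSeminorm_sub hdiam (by linarith) hrε) hδr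
  obtain ⟨x, hx, hfgx⟩ := exists_lt_apply_of_lt_norm hfg
  replace hfgx : δ < f x - g x := hfgx
  let eval : StrongDual ℝ (WeakDual ℝ X) := WeakBilin.eval (topDualPairing ℝ X) x
  let a : ℝ := (f x + g x - δ) / 2
  have haf : a + δ < eval f := by change _ < f x; simp only [a]; linarith
  have hag : -a < -eval g := by change _ < -g x; simp only [a]; linarith
  obtain ⟨C₀, hC₀, hLC₀, h₀⟩ := hL.exists_superset_forall_lt isCompact_dualUnitBall
    convex_dualUnitBall hf eval haf ⟨g, hg.1.1, by linarith⟩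
  obtain ⟨C₁, hC₁, hLC₁, h₁⟩ := hL.exists_superset_forall_lt isCompact_dualUnitBall
    convex_dualUnitBall hg (-eval) hag ⟨f, hf.1.1, by change -eval f ≤ _; linarith⟩
  exact ⟨x, hx, a, fun b => bif b then C₁ else C₀,
    Bool.rec ⟨hC₀, hLC₀⟩ ⟨hC₁, hLC₁⟩, fun h hh => (h₀ h hh).le,
    fun h hh => (neg_lt_neg_iff.mp (h₁ h hh)).le⟩

/-- A dyadic tree in the dual such that, at every node, some vector of the unit ball separates all
descendants of one child from all descendants of the other by a gap `δ`. Words carry their newest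
letter first, as in `PiNat.res`, so that the descendants of a node are the words having it as a
suffix. -/
def IsSeparatedTree (δ : ℝ) (p : List Bool → StrongDual ℝ X) : Prop :=
  ∀ s, ∃ x : X, ‖x‖ ≤ 1 ∧ ∃ a, ∀ t,
    (false :: s <:+ t → a + δ ≤ p t x) ∧ (true :: s <:+ t → p t x ≤ a)

lemma isProperCompactConvex_zero [Nontrivial X] :
    IsProperCompactConvex {0} (dualUnitBall X) where
  nonempty := Set.singleton_nonempty 0
  isCompact := isCompact_singleton
  convex := convex_singleton 0
  ssubset := by
    obtain ⟨f, hf, -⟩ := exists_dual_vector' ℝ (0 : X)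
    refine (Set.ssubset_iff_of_subset ?_).mpr ⟨StrongDual.toWeakDual f, ?_, ?_⟩
    · simp [mem_dualUnitBall]
    · exact mem_dualUnitBall.mpr hf.le
    · rintro (hf₀ : f = 0)
      simp [hf₀] at hf

lemma exists_isSeparatedTree [Nontrivial X] {ε δ : ℝ}
    (hdiam : ∀ x : X, ‖x‖ = 1 → ∀ δ > 0, ε ≤ Metric.diam (weakStarSlice x δ))
    (hδ : 0 < δ) (hδε : 2 * δ < ε) :
    ∃ p : List Bool → StrongDual ℝ X, (∀ s, ‖p s‖ ≤ 1) ∧ IsSeparatedTree δ p := by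
  choose! x hx a C hC h₀ h₁ using fun L : Set (WeakDual ℝ X) =>
    exists_separating_extensions (L := L) hdiam hδ hδε
  let node (s : List Bool) : Set (WeakDual ℝ X) := s.foldr (fun b L => C L b) {0}
  have hnode (s) : IsProperCompactConvex (node s) (dualUnitBall X) := by
    induction s with
    | nil => exact isProperCompactConvex_zero
    | cons b s ih => exact (hC _ ih b).1
  have hmono {s t : List Bool} (hst : s <:+ t) : node s ⊆ node t := by
    obtain ⟨u, rfl⟩ := hst
    induction u with
    | nil => exact subset_rfl
    | cons b u ih => exact ih.trans (hC _ (hnode _) b).2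
  choose p hp hpnode using fun s => Set.exists_of_ssubset (hnode s).ssubset
  have hout {s t : List Bool} (hst : s <:+ t) : p t ∈ dualUnitBall X \ node s :=
    ⟨hp t, fun h => hpnode t (hmono hst h)⟩
  exact ⟨fun s => WeakDual.toStrongDual (p s), fun s => mem_dualUnitBall.mp (hp s), fun s =>
    ⟨x (node s), hx _ (hnode s), a (node s), fun t =>
      ⟨fun ht => h₀ _ (hnode s) _ (hout ht), fun ht => h₁ _ (hnode s) _ (hout ht)⟩⟩⟩

end DualBall

section VectorMeasures

variable {X Ω ι : Type*} [NormedAddCommGroup X] [NormedSpace ℝ X] [MeasurableSpace Ω]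

lemma exists_norm_le_tendsto_apply (𝒰 : Ultrafilter ι) {v : ι → StrongDual ℝ X} {r : ℝ}
    (hv : ∀ i, ‖v i‖ ≤ r) :
    ∃ f : StrongDual ℝ X, ‖f‖ ≤ r ∧ ∀ x, Tendsto (fun i => v i x) 𝒰 (𝓝 (f x)) := by
  obtain ⟨f, hf, hle⟩ := (WeakDual.isCompact_closedBall (𝕜 := ℝ) (0 : StrongDual ℝ X)
    r).ultrafilter_le_nhds' (𝒰.map fun i => StrongDual.toWeakDual (v i))
      (Ultrafilter.mem_map.mpr (univ_mem' fun i => mem_closedBall_zero_iff.mpr (hv i)))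
  exact ⟨WeakDual.toStrongDual f, mem_closedBall_zero_iff.mp hf,
    fun x => ((WeakDual.eval_continuous x).tendsto f).comp hle⟩

lemma exists_vectorMeasure_tendsto (𝒰 : Ultrafilter ι) (μ : Measure Ω) [IsFiniteMeasure μ]
    {u : ι → Ω → StrongDual ℝ X} (hu : ∀ i, Integrable (u i) μ) (hu1 : ∀ i ω, ‖u i ω‖ ≤ 1) :
    ∃ G : VectorMeasure Ω (StrongDual ℝ X), (∀ A, ‖G A‖ₑ ≤ μ A) ∧
      ∀ A, MeasurableSet A → ∀ x,
        Tendsto (fun i => ∫ ω in A, u i ω x ∂μ) 𝒰 (𝓝 (G A x)) := by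
  classical
  have hbound (A : Set Ω) (i : ι) : ‖∫ ω in A, u i ω ∂μ‖ ≤ μ.real A :=
    (norm_setIntegral_le_of_norm_le_const (measure_lt_top μ A)
      fun ω _ => hu1 i ω).trans_eq (one_mul _)
  choose L hLle hL using fun A => exists_norm_le_tendsto_apply 𝒰 (hbound A)
  simp only [fun A i => ContinuousLinearMap.integral_apply (μ := μ.restrict A) (hu i).integrableOn]
    at hL
  let m (A : Set Ω) : StrongDual ℝ X := if MeasurableSet A then L A else 0
  have hm (A : Set Ω) : ‖m A‖ₑ ≤ μ A := by
    by_cases hA : MeasurableSet A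
    · simp only [m, if_pos hA]
      rw [← ofReal_norm, ← ofReal_measureReal]
      exact ENNReal.ofReal_le_ofReal (hLle A)
    · simp only [m, if_neg hA]
      exact (enorm_zero (E := StrongDual ℝ X)).trans_le zero_le
  have hadd (A B : Set Ω) (hA : MeasurableSet A) (hB : MeasurableSet B) (hAB : Disjoint A B) :
      m (A ∪ B) = m A + m B := by
    simp only [m, if_pos hA, if_pos hB, if_pos (hA.union hB)]
    ext x
    refine tendsto_nhds_unique (hL (A ∪ B) x) (((hL A x).add (hL B x)).congr fun i => ?_)
    have hint : Integrable (fun ω => u i ω x) μ := (hu i).apply_continuousLinearMap x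
    exact (setIntegral_union hAB hB hint.integrableOn hint.integrableOn).symm
  refine ⟨.of_additive_of_le_measure m hm hadd fun A hA => if_neg hA, hm, fun A hA x => ?_⟩
  change Tendsto _ _ (𝓝 (m A x))
  simpa only [m, if_pos hA] using hL A x

lemma exists_setIntegral_preimage_singleton_lt [Countable ι] {μ : Measure Ω} [IsFiniteMeasure μ]
    {f : Ω → ℝ} (hf : Integrable f μ) {c : ℝ} (hfc : ∫ ω, f ω ∂μ < c * μ.real Set.univ)
    {r : Ω → ι} (hr : ∀ i, MeasurableSet (r ⁻¹' {i})) :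
    ∃ i, ∫ ω in r ⁻¹' {i}, f ω ∂μ < c * μ.real (r ⁻¹' {i}) := by
  by_contra! hle
  have hcover : ⋃ i, r ⁻¹' {i} = Set.univ :=
    Set.iUnion_eq_univ_iff.mpr fun ω => ⟨r ω, rfl⟩
  have hdisj : Pairwise (Function.onFun Disjoint fun i => r ⁻¹' {i}) := fun i j hij =>
    (Set.disjoint_singleton.mpr hij).preimage r
  have hsum (h : Ω → ℝ) (hh : Integrable h μ) :
      HasSum (fun i => ∫ ω in r ⁻¹' {i}, h ω ∂μ) (∫ ω, h ω ∂μ) := by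
    rw [← setIntegral_univ, ← hcover]
    exact hasSum_integral_iUnion hr hdisj hh.integrableOn
  have hconst : HasSum (fun i => c * μ.real (r ⁻¹' {i})) (c * μ.real Set.univ) := by
    simpa [mul_comm] using hsum _ (integrable_const c)
  exact hfc.not_ge (hasSum_le hle hconst (hsum f hf))

end VectorMeasures

section InfiniteWords

open PiNat (res)

variable {α : Type*}

lemma res_isSuffix_res (ω : ℕ → α) {m n : ℕ} (h : m ≤ n) : res ω m <:+ res ω n := by
  induction n, h using Nat.le_induction with
  | base => exact List.suffix_rfl
  | succ n _ ih => exact ih.trans (List.suffix_cons _ _)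

variable [TopologicalSpace α] [DiscreteTopology α]

lemma isLocallyConstant_res (n : ℕ) : IsLocallyConstant fun ω : ℕ → α => res ω n :=
  IsLocallyConstant.iff_exists_open _ |>.mpr fun ω =>
    ⟨PiNat.cylinder ω n, PiNat.isOpen_cylinder _ ω n, PiNat.self_mem_cylinder ω n,
      fun _ h => (PiNat.cylinder_eq_res ω n ▸ h :)⟩

lemma exists_forall_cylinder_dist_lt [Finite α] {E : Type*} [PseudoMetricSpace E]
    {h : (ℕ → α) → E} (hh : Continuous h) {ε : ℝ} (hε : 0 < ε) :
    ∃ n, ∀ ω, ∀ ω' ∈ PiNat.cylinder ω n, dist (h ω') (h ω) < ε := by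
  let _ : MetricSpace (ℕ → α) := PiNat.metricSpace
  obtain ⟨δ, hδ, hδε⟩ :=
    Metric.uniformContinuous_iff.mp (CompactSpace.uniformContinuous_of_continuous hh) ε hε
  obtain ⟨n, hn⟩ := exists_pow_lt_of_lt_one hδ one_half_lt_one
  exact ⟨n, fun ω ω' hω' => hδε ((PiNat.mem_cylinder_iff_dist_le.mp hω').trans_lt hn)⟩

lemma exists_cylinder_setIntegral_norm_sub_lt [Finite α] [MeasurableSpace α] [BorelSpace α]
    {μ : Measure (ℕ → α)} [IsFiniteMeasure μ] [NeZero μ] {E : Type*} [NormedAddCommGroup E]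
    [NormedSpace ℝ E] {g : (ℕ → α) → E} (hg : Integrable g μ) {ε : ℝ} (hε : 0 < ε) :
    ∃ ω n c, ∫ ω' in PiNat.cylinder ω n, ‖g ω' - c‖ ∂μ < ε * μ.real (PiNat.cylinder ω n) := by
  have hμ : 0 < μ.real Set.univ := measureReal_univ_pos
  obtain ⟨h, -, hgh, hcont, hh⟩ := hg.exists_hasCompactSupport_integral_sub_le
    (ε := ε / 3 * μ.real Set.univ) (by positivity)
  obtain ⟨n, hn⟩ := exists_forall_cylinder_dist_lt hcont (half_pos hε)
  obtain ⟨s, hs⟩ := exists_setIntegral_preimage_singleton_lt (hg.sub hh).norm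
    (hgh.trans_lt (mul_lt_mul_of_pos_right (by linarith) hμ) : _ < ε / 2 * _)
    fun s => ((isLocallyConstant_res n).isOpen_fiber s).measurableSet
  obtain ⟨ω, rfl⟩ : ((res · n) ⁻¹' {s}).Nonempty := by
    by_contra! hempty
    simp [hempty] at hs
  refine ⟨ω, n, h ω, ?_⟩
  have hcyl : (res · n) ⁻¹' {res ω n} = PiNat.cylinder ω n := (PiNat.cylinder_eq_res ω n).symm
  rw [hcyl] at hs
  calc ∫ ω' in PiNat.cylinder ω n, ‖g ω' - h ω‖ ∂μ
      ≤ ∫ ω' in PiNat.cylinder ω n, (‖g ω' - h ω'‖ + ε / 2) ∂μ := by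
        refine setIntegral_mono_on (hg.sub (integrable_const _)).norm.integrableOn
          ((hg.sub hh).norm.add (integrable_const _)).integrableOn
          (PiNat.isOpen_cylinder _ ω n).measurableSet fun ω' hω' => ?_
        refine (norm_sub_le_norm_sub_add_norm_sub _ (h ω') _).trans ?_
        exact add_le_add_right ((dist_eq_norm (h ω') (h ω)).ge.trans (hn ω ω' hω').le) _
    _ = ∫ ω' in PiNat.cylinder ω n, ‖g ω' - h ω'‖ ∂μ + ε / 2 * μ.real (PiNat.cylinder ω n) := by
        rw [integral_add (f := fun ω' => ‖g ω' - h ω'‖) (hg.sub hh).norm.integrableOn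
          (integrable_const _), setIntegral_const, smul_eq_mul, mul_comm (ε / 2)]
    _ < ε / 2 * μ.real (PiNat.cylinder ω n) + ε / 2 * μ.real (PiNat.cylinder ω n) := by
        gcongr
        exact hs
    _ = ε * μ.real (PiNat.cylinder ω n) := by ring

end InfiniteWords

section CoinTosses

open PiNat (res)

/-- The law of infinitely many independent fair coin tosses. -/
noncomputable def coinMeasure : Measure (ℕ → Bool) :=
  Measure.infinitePi fun _ => (PMF.uniformOfFintype Bool).toMeasure

instance : IsProbabilityMeasure coinMeasure := by
  unfold coinMeasure
  infer_instance

lemma coinMeasure_real_cylinder (ω : ℕ → Bool) (n : ℕ) :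
    coinMeasure.real (PiNat.cylinder ω n) = (1 / 2) ^ n := by
  rw [Measure.real, PiNat.cylinder_eq_pi, coinMeasure,
    Measure.infinitePi_pi _ fun _ _ => .of_discrete]
  simp [PMF.uniformOfFintype_apply]

/-- The half of the cylinder `PiNat.cylinder ω n` consisting of the words whose `n`-th letter
is `b`. -/
def halfCylinder (ω : ℕ → Bool) (n : ℕ) (b : Bool) : Set (ℕ → Bool) :=
  PiNat.cylinder (Function.update ω n b) (n + 1)

variable {ω ω' : ℕ → Bool} {n m : ℕ} {b : Bool}

lemma measurableSet_halfCylinder : MeasurableSet (halfCylinder ω n b) :=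
  (PiNat.isOpen_cylinder _ _ _).measurableSet

lemma halfCylinder_union_halfCylinder :
    halfCylinder ω n false ∪ halfCylinder ω n true = PiNat.cylinder ω n := by
  rw [← PiNat.iUnion_cylinder_update, Set.union_comm, Set.union_eq_iUnion]
  exact Set.iUnion_congr (Bool.rec rfl rfl)

lemma disjoint_halfCylinder : Disjoint (halfCylinder ω n false) (halfCylinder ω n true) := by
  refine Set.disjoint_left.mpr fun ω' h₀ h₁ => ?_
  have := (h₀ n n.lt_succ_self).symm.trans (h₁ n n.lt_succ_self)
  simp at this

lemma cons_res_isSuffix_res (hω' : ω' ∈ halfCylinder ω n b) (hm : n < m) :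
    b :: res ω n <:+ res ω' m := by
  have hres : res ω' (n + 1) = b :: res ω n := by
    rw [halfCylinder, PiNat.cylinder_eq_res] at hω'
    rw [hω'.out, PiNat.res_succ, Function.update_self]
    congr 1
    exact PiNat.res_eq_res.mpr fun k hk => Function.update_of_ne hk.ne _ _
  exact hres ▸ res_isSuffix_res ω' hm

lemma exists_norm_setIntegral_halfCylinder_sub_lt {E : Type*} [NormedAddCommGroup E]
    [NormedSpace ℝ E] [CompleteSpace E] {g : (ℕ → Bool) → E} (hg : Integrable g coinMeasure)
    {ε : ℝ} (hε : 0 < ε) :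
    ∃ ω n, ‖∫ ω' in halfCylinder ω n false, g ω' ∂coinMeasure -
      ∫ ω' in halfCylinder ω n true, g ω' ∂coinMeasure‖ < ε * (1 / 2) ^ n := by
  obtain ⟨ω, n, c, hc⟩ := exists_cylinder_setIntegral_norm_sub_lt hg hε
  rw [coinMeasure_real_cylinder] at hc
  refine ⟨ω, n, hc.trans_le' ?_⟩
  have hgc : Integrable (fun ω' => g ω' - c) coinMeasure := hg.sub (integrable_const c)
  have hcenter (b : Bool) : ∫ ω' in halfCylinder ω n b, g ω' ∂coinMeasure =
      ∫ ω' in halfCylinder ω n b, (g ω' - c) ∂coinMeasure + (1 / 2 : ℝ) ^ (n + 1) • c := by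
    rw [integral_sub hg.integrableOn (integrable_const c), setIntegral_const, halfCylinder,
      coinMeasure_real_cylinder, sub_add_cancel]
  rw [hcenter, hcenter, add_sub_add_right_eq_sub, ← halfCylinder_union_halfCylinder,
    setIntegral_union disjoint_halfCylinder measurableSet_halfCylinder hgc.norm.integrableOn
      hgc.norm.integrableOn]
  exact (norm_sub_le _ _).trans
    (add_le_add (norm_integral_le_integral_norm _) (norm_integral_le_integral_norm _))

variable {X : Type*} [NormedAddCommGroup X] [NormedSpace ℝ X]

lemma IsSeparatedTree.exists_vectorMeasure {p : List Bool → StrongDual ℝ X} {δ : ℝ}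
    (hp : IsSeparatedTree δ p) (hp1 : ∀ s, ‖p s‖ ≤ 1) :
    ∃ G : VectorMeasure (ℕ → Bool) (StrongDual ℝ X), (∀ A, ‖G A‖ₑ ≤ coinMeasure A) ∧
      ∀ ω n, δ / 2 * (1 / 2) ^ n ≤ ‖G (halfCylinder ω n false) - G (halfCylinder ω n true)‖ := by
  have hint (m : ℕ) : Integrable (fun ω => p (res ω m)) coinMeasure :=
    ((isLocallyConstant_res m).comp p).continuous.integrable_of_hasCompactSupport
      (.of_compactSpace _)
  obtain ⟨G, hGle, hG⟩ :=
    exists_vectorMeasure_tendsto (hyperfilter ℕ) coinMeasure hint fun m ω => hp1 (res ω m)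
  have hlower {ω n b} {x : X} {c : ℝ} (h : ∀ t, b :: res ω n <:+ t → c ≤ p t x) :
      (1 / 2) ^ (n + 1) * c ≤ G (halfCylinder ω n b) x := by
    refine ge_of_tendsto (hG _ measurableSet_halfCylinder x)
      (Nat.hyperfilter_le_atTop ((eventually_gt_atTop n).mono fun m hm => ?_))
    rw [← coinMeasure_real_cylinder (Function.update ω n b), ← smul_eq_mul, ← setIntegral_const]
    exact setIntegral_mono_on (integrable_const c)
      ((hint m).apply_continuousLinearMap x).integrableOn measurableSet_halfCylinder
      fun ω' hω' => h _ (cons_res_isSuffix_res hω' hm)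
  refine ⟨G, hGle, fun ω n => ?_⟩
  obtain ⟨x, hx, a, hxa⟩ := hp (res ω n)
  have hfalse := hlower fun t => (hxa t).1
  have htrue := hlower (x := -x) (c := -a) fun t ht => by
    simpa using (hxa t).2 ht
  rw [map_neg] at htrue
  calc δ / 2 * (1 / 2) ^ n
      ≤ G (halfCylinder ω n false) x - G (halfCylinder ω n true) x := by
        rw [pow_succ] at hfalse htrue
        linarith
    _ ≤ ‖G (halfCylinder ω n false) - G (halfCylinder ω n true)‖ :=
        (le_abs_self _).trans <|
          (G (halfCylinder ω n false) - G (halfCylinder ω n true)).unit_le_opNorm x hx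

lemma RadonNikodymProperty.exists_density {E : Type*} [NormedAddCommGroup E] [NormedSpace ℝ E]
    (h : RadonNikodymProperty E) {Ω : Type} [MeasurableSpace Ω] {μ : Measure Ω}
    [IsFiniteMeasure μ] {G : VectorMeasure Ω E} (hG : ∀ A, ‖G A‖ₑ ≤ μ A) :
    ∃ g : Ω → E, Integrable g μ ∧ ∀ A, MeasurableSet A → G A = ∫ ω in A, g ω ∂μ :=
  h Ω μ G
    ((VectorMeasure.variation_le_of_forall_enorm_le (fun A _ => hG A) _).trans_lt
      (measure_lt_top μ _))
    fun A _ hA => enorm_eq_zero.mp (le_zero_iff.mp (hA ▸ hG A))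

theorem RadonNikodymProperty.exists_diam_weakStarSlice_lt [Nontrivial X]
    (h : RadonNikodymProperty (StrongDual ℝ X)) {ε : ℝ} (hε : 0 < ε) :
    ∃ x : X, ‖x‖ = 1 ∧ ∃ δ > 0, Metric.diam (weakStarSlice x δ) < ε := by
  by_contra! hdiam
  obtain ⟨p, hp1, hp⟩ := exists_isSeparatedTree hdiam (δ := ε / 3) (by linarith) (by linarith)
  obtain ⟨G, hGle, hG⟩ := hp.exists_vectorMeasure hp1
  obtain ⟨g, hg, hGg⟩ := h.exists_density hGle
  obtain ⟨ω, n, hlt⟩ := exists_norm_setIntegral_halfCylinder_sub_lt hg (ε := ε / 3 / 2)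
    (by linarith)
  refine hlt.not_ge ?_
  simpa only [hGg _ measurableSet_halfCylinder] using hG ω n

end CoinTosses

section Slices

variable {X : Type*} [NormedAddCommGroup X] [NormedSpace ℝ X]

lemma isBounded_weakStarSlice (x : X) (δ : ℝ) : Bornology.IsBounded (weakStarSlice x δ) :=
  Metric.isBounded_closedBall.subset fun _ hf => mem_closedBall_zero_iff.mpr hf.1

theorem LD2PPlus.two_le_diam_weakStarSlice (h : LD2PPlus X) {x : X} (hx : ‖x‖ = 1) {δ : ℝ}
    (hδ : 0 < δ) : 2 ≤ Metric.diam (weakStarSlice x δ) := by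
  refine le_of_forall_pos_sub_le fun η hη => ?_
  obtain ⟨f, hf, hfx⟩ := exists_dual_vector ℝ x (hx ▸ one_ne_zero)
  replace hfx : f x = 1 := by rw [hfx, hx]; rfl
  obtain ⟨r, hr, hrδ, hrη, hr1⟩ : ∃ r > 0, r ≤ δ ∧ 2 * r ≤ η ∧ r ≤ 1 :=
    ⟨min δ (min (η / 2) 1), by positivity, min_le_left _ _,
      by linarith [min_le_right δ (min (η / 2) 1), min_le_left (η / 2) 1],
      (min_le_right _ _).trans (min_le_right _ _)⟩
  obtain ⟨y, ⟨hy, hfy⟩, hxy⟩ := h f hf r hr r hr x ⟨hx.le, by linarith⟩ hx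
  obtain ⟨g, hg, hgxy⟩ := exists_dual_vector ℝ (x - y) (by linarith)
  replace hgxy : g x - g y = ‖x - y‖ := by rw [← map_sub, hgxy]; rfl
  have hgx : g x ≤ 1 := (le_abs_self _).trans (hg ▸ g.unit_le_opNorm x hx.le)
  have hgy : -1 ≤ g y := (abs_le.mp (hg ▸ g.unit_le_opNorm y hy : ‖g y‖ ≤ 1)).1
  have hfslice : f ∈ weakStarSlice x δ := ⟨hf.le, by linarith⟩
  have hgslice : g ∈ weakStarSlice x δ := ⟨hg.le, by linarith⟩
  calc 2 - η ≤ f y - g y := by linarith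
    _ ≤ ‖f - g‖ := (le_abs_self _).trans ((f - g).unit_le_opNorm y hy)
    _ = dist f g := (dist_eq_norm f g).symm
    _ ≤ Metric.diam (weakStarSlice x δ) :=
      Metric.dist_le_diam_of_mem (isBounded_weakStarSlice x δ) hfslice hgslice

end Slices

end LocalDiameterTwo

theorem corollary3p6_general (X : Type*) [NormedAddCommGroup X] [NormedSpace ℝ X] [Nontrivial X] :
    ((∃ f : StrongDual ℝ X, LocalDiameterTwo.IsWeakStarDentingPoint f) →
      ¬ LocalDiameterTwo.LD2PPlus X) ∧
    (LocalDiameterTwo.RadonNikodymProperty (StrongDual ℝ X) →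
      ¬ LocalDiameterTwo.LD2PPlus X) := by
  refine ⟨fun ⟨f, hf⟩ h => ?_, fun hRN h => ?_⟩
  · obtain ⟨x, hx, δ, hδ, -, hdiam⟩ := hf.2 2 two_pos
    exact hdiam.not_ge (h.two_le_diam_weakStarSlice hx hδ)
  · obtain ⟨x, hx, δ, hδ, hdiam⟩ := hRN.exists_diam_weakStarSlice_lt two_pos
    exact hdiam.not_ge (h.two_le_diam_weakStarSlice hx hδ)

theorem corollary3p6 (X : Type*) [NormedAddCommGroup X] [NormedSpace ℝ X] [CompleteSpace X]
    [Nontrivial X] :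
    ((∃ f : StrongDual ℝ X, LocalDiameterTwo.IsWeakStarDentingPoint f) →
      ¬ LocalDiameterTwo.LD2PPlus X) ∧
    (LocalDiameterTwo.RadonNikodymProperty (StrongDual ℝ X) →
      ¬ LocalDiameterTwo.LD2PPlus X) := by
  exact corollary3p6_general X
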